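/- Let $n\ge 1$, let $Q$ be any real quadratic form on $\mathbb R^n$ (no assumption on its rank, signature or eigenvalues), let $\Omega=[0,1]^n$, and let $S=\{(\xi,Q(\xi)):\xi\in\Omega\}\subset\mathbb R^{n+1}$. Functions on $S$ are identified with functions of $\xi\in\Omega$, and $L^q(S)$ means $L^q(\Omega)$ with respect to Lebesgue measure. The extension operator is $$\mathcal E f(x,t)=\int_\Omega f(\xi)\,e^{i(x\cdot\xi+tQ(\xi))}\,d\xi,\qquad (x,t)\in\mathbb R^n\times\mathbb R .$$ Let $D$ be the set of signed characteristic functions, that is, of measurable functions $g:\Omega\to\{0\}\cup\{z\in\mathbb C:|z|=1\}$. Let $p_0>\frac{2n+2}{n}$ and suppose that there is a constant $C<\infty$ such that $$\|\mathcal E g\|_{L^{p_0}(\mathbb R^{n+1})}\le C\,\|g\|_{L^\infty(S)}\qquad\text{for all } g\in D .$$ Then for every $p$ with $p_0<p\le\infty$ the operator $\mathcal E$ is bounded from $L^p(S)$ to $L^p(\mathbb R^{n+1})$: there is a constant $C'<\infty$ such that for all $g\in L^p(S)$ one has $\mathcal E g\in L^p(\mathbb R^{n+1})$ and $$\|\mathcal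 E g\|_{L^p(\mathbb R^{n+1})}\le C'\,\|g\|_{L^p(S)} .$$ -/

import Mathlib

open MeasureTheory
open scoped ENNReal NNReal

namespace QuadricExtension

/-- The parameter domain `Ω = [0,1]^n`. -/
def unitCube (n : ℕ) : Set (Fin n → ℝ) := Set.Icc 0 1

/-- The measure on the quadric `S = {(ξ, Q ξ) : ξ ∈ Ω}`, read in the parameter `ξ`: Lebesgue measure
on `Ω`. Functions on `S` are identified with functions of `ξ`, and `L^q(S)` with `L^q(Ω)`. -/
noncomputable def quadricMeasure (n : ℕ) : Measure (Fin n → ℝ) := volume.restrict (unitCube n)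

/-- The extension operator
`(𝓔 f)(x, t) = ∫_Ω f(ξ) exp(i (x · ξ + t Q(ξ))) dξ`, for `(x, t) ∈ ℝ^n × ℝ = ℝ^{n+1}`. -/
noncomputable def extensionOp {n : ℕ} (Q : QuadraticForm ℝ (Fin n → ℝ)) (f : (Fin n → ℝ) → ℂ)
    (z : (Fin n → ℝ) × ℝ) : ℂ :=
  ∫ ξ, f ξ * Complex.exp (Complex.I * ((z.1 ⬝ᵥ ξ + z.2 * Q ξ : ℝ) : ℂ)) ∂(quadricMeasure n)

/-- The signed characteristic functions: measurable `f : Ω → {0} ∪ {z ∈ ℂ : |z| = 1}`, extended by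
zero to `ℝ^n`. -/
def signedCharFun (n : ℕ) : Set ((Fin n → ℝ) → ℂ) :=
  {f | Measurable f ∧ (∀ ξ ∈ unitCube n, f ξ = 0 ∨ ‖f ξ‖ = 1) ∧ ∀ ξ ∉ unitCube n, f ξ = 0}

end QuadricExtension

/-! The heart is a restricted strong type bound at `q = p₀`: if `|f| ≤ 1` and `f` is supported in `A
⊆ Ω`, then `‖𝓔f‖_q^q ≲ |A|` (`extEnergy_le_volume`). The hypothesis, extended to all bounded
functions, gives only `≲ 1`; the factor `|A|` comes from packing about `1/|A|` copies of `f` into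
one bounded function (`exists_packing`).

A translation of `f` changes `𝓔f` by a unimodular factor and a shear, so it preserves the energy
`‖𝓔f‖_q^q`, whatever `Q` is. Translates may overlap what is already placed; averaging over the
translation shows that some reweighted translate, cut off outside the occupied set, keeps a fraction
`2^(-q)` of the energy (`exists_extEnergy_disjoint_translate`). As `q ≥ 2`, Clarkson's inequality
supplies a sign for which energies add without loss (`exists_sign_extEnergy_add_le`). The packed
function is bounded by one on `[0,2]^n`, so its energy is bounded by a constant.

For `p > q` finite, the trivial bound `|𝓔f| ≤ |A|` improves this to `‖𝓔f‖_p^p ≲ |A|^(1+p-q)`. The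
gain makes the dyadic layers of an `L^p` function sum geometrically
(`RestrictedBound.exists_eLpNorm_le`). -/

namespace QuadricExtension

variable {n : ℕ}

/-! ### The extension operator: elementary properties -/

/-- The oscillating kernel `exp(i (x · ξ + t Q(ξ)))`. -/
noncomputable def osc (Q : QuadraticForm ℝ (Fin n → ℝ)) (z : (Fin n → ℝ) × ℝ)
    (ξ : Fin n → ℝ) : ℂ :=
  Complex.exp (Complex.I * ((z.1 ⬝ᵥ ξ + z.2 * Q ξ : ℝ) : ℂ))

/-- The extension operator for functions on the whole parameter space. -/
noncomputable def fullExt (Q : QuadraticForm ℝ (Fin n → ℝ)) (f : (Fin n → ℝ) → ℂ)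
    (z : (Fin n → ℝ) × ℝ) : ℂ :=
  ∫ ξ, f ξ * osc Q z ξ

/-- The `q`-th power of the `L^q` norm of the extension of `f`. -/
noncomputable def extEnergy (Q : QuadraticForm ℝ (Fin n → ℝ)) (q : ℝ)
    (f : (Fin n → ℝ) → ℂ) : ℝ≥0∞ :=
  ∫⁻ z, ‖fullExt Q f z‖ₑ ^ q

lemma measurableSet_unitCube : MeasurableSet (unitCube n) := measurableSet_Icc

lemma volume_unitCube : volume (unitCube n) = 1 := by
  simp [unitCube, Real.volume_Icc_pi]

lemma volume_ne_top_of_subset_unitCube {A : Set (Fin n → ℝ)} (hA : A ⊆ unitCube n) :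
    volume A ≠ ∞ := ((measure_mono hA).trans_lt (by rw [volume_unitCube]; simp)).ne

instance : IsProbabilityMeasure (quadricMeasure n) :=
  ⟨by simp [quadricMeasure, volume_unitCube]⟩

lemma extensionOp_eq_fullExt (Q : QuadraticForm ℝ (Fin n → ℝ)) (f : (Fin n → ℝ) → ℂ)
    (hf : ∀ ξ ∉ unitCube n, f ξ = 0) : extensionOp Q f = fullExt Q f := by
  ext z
  rw [extensionOp, fullExt, quadricMeasure]
  refine setIntegral_eq_integral_of_forall_compl_eq_zero fun ξ hξ => ?_
  rw [hf ξ hξ, zero_mul]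

lemma continuous_quadraticForm (Q : QuadraticForm ℝ (Fin n → ℝ)) : Continuous fun ξ => Q ξ := by
  have h : (fun ξ => Q ξ) =
      fun ξ => (QuadraticMap.associated (R := ℝ) Q).toContinuousBilinearMap ξ ξ := by
    ext ξ
    rw [LinearMap.toContinuousBilinearMap_apply]
    exact (QuadraticMap.associated_eq_self_apply ℝ Q ξ).symm
  rw [h]
  fun_prop

lemma continuous_osc (Q : QuadraticForm ℝ (Fin n → ℝ)) :
    Continuous fun w : ((Fin n → ℝ) × ℝ) × (Fin n → ℝ) => osc Q w.1 w.2 := by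
  have hQ := continuous_quadraticForm Q
  unfold osc dotProduct
  fun_prop

lemma continuous_osc_right (Q : QuadraticForm ℝ (Fin n → ℝ)) (z : (Fin n → ℝ) × ℝ) :
    Continuous (osc Q z) :=
  (continuous_osc Q).comp (by fun_prop : Continuous fun ξ : Fin n → ℝ => (z, ξ))

lemma norm_osc (Q : QuadraticForm ℝ (Fin n → ℝ)) (z : (Fin n → ℝ) × ℝ) (ξ : Fin n → ℝ) :
    ‖osc Q z ξ‖ = 1 := by
  rw [osc, mul_comm, Complex.norm_exp_ofReal_mul_I]

lemma integrable_mul_osc (Q : QuadraticForm ℝ (Fin n → ℝ)) (z : (Fin n → ℝ) × ℝ)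
    {f : (Fin n → ℝ) → ℂ} (hf : Integrable f) : Integrable fun ξ => f ξ * osc Q z ξ :=
  hf.mul_bdd (c := 1) (continuous_osc_right Q z).aestronglyMeasurable
    (ae_of_all _ fun ξ => (norm_osc Q z ξ).le)

lemma enorm_fullExt_le (Q : QuadraticForm ℝ (Fin n → ℝ)) (f : (Fin n → ℝ) → ℂ)
    (z : (Fin n → ℝ) × ℝ) : ‖fullExt Q f z‖ₑ ≤ ∫⁻ ξ, ‖f ξ‖ₑ := by
  refine (enorm_integral_le_lintegral_enorm _).trans_eq ?_
  refine lintegral_congr fun ξ => ?_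
  rw [enorm_mul, ← ofReal_norm (osc Q z ξ), norm_osc, ENNReal.ofReal_one, mul_one]

lemma stronglyMeasurable_fullExt (Q : QuadraticForm ℝ (Fin n → ℝ)) {f : (Fin n → ℝ) → ℂ}
    (hf : Measurable f) : StronglyMeasurable (fullExt Q f) := by
  refine StronglyMeasurable.integral_prod_right
    (f := fun z ξ => f ξ * osc Q z ξ) ?_
  exact ((hf.comp measurable_snd).mul (continuous_osc Q).measurable).stronglyMeasurable

lemma fullExt_add (Q : QuadraticForm ℝ (Fin n → ℝ)) {f g : (Fin n → ℝ) → ℂ}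
    (hf : Integrable f) (hg : Integrable g) :
    fullExt Q (f + g) = fullExt Q f + fullExt Q g := by
  ext z
  simp only [fullExt, Pi.add_apply, add_mul]
  exact integral_add (integrable_mul_osc Q z hf) (integrable_mul_osc Q z hg)

lemma fullExt_smul (Q : QuadraticForm ℝ (Fin n → ℝ)) (c : ℂ) (f : (Fin n → ℝ) → ℂ) :
    fullExt Q (c • f) = c • fullExt Q f := by
  ext z
  simp only [fullExt, Pi.smul_apply, smul_eq_mul, mul_assoc]
  exact integral_const_mul _ _

lemma fullExt_eq_zero_of_ae (Q : QuadraticForm ℝ (Fin n → ℝ)) {f : (Fin n → ℝ) → ℂ}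
    (hf : f =ᵐ[volume] 0) : fullExt Q f = 0 := by
  ext z
  refine integral_eq_zero_of_ae ?_
  filter_upwards [hf] with ξ hξ
  simp [hξ]

/-! ### Translation and dilation symmetries -/

/-- The dual vector `w` with `w · ξ = Q(ξ + v) - Q(ξ) - Q(v)`. -/
noncomputable def polarVec (Q : QuadraticForm ℝ (Fin n → ℝ)) (v : Fin n → ℝ) : Fin n → ℝ :=
  fun i => QuadraticMap.polar Q (Pi.single i 1) v

lemma polarVec_dotProduct (Q : QuadraticForm ℝ (Fin n → ℝ)) (v ξ : Fin n → ℝ) :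
    polarVec Q v ⬝ᵥ ξ = QuadraticMap.polar Q ξ v := by
  have h := LinearMap.pi_apply_eq_sum_univ (Q.polarBilin.flip v) ξ
  simp only [LinearMap.flip_apply, QuadraticMap.polarBilin_apply_apply, smul_eq_mul] at h
  rw [h, dotProduct]
  refine Finset.sum_congr rfl fun i _ => ?_
  rw [mul_comm, polarVec]
  congr 2
  ext j
  simp [Pi.single_apply, eq_comm]

/-- Galilean symmetry: the cross term of `Q (ξ + v)` is linear in `ξ`, so multiplied by `t` it is
absorbed into the frequency `x`. -/
lemma osc_add (Q : QuadraticForm ℝ (Fin n → ℝ)) (z : (Fin n → ℝ) × ℝ) (ξ v : Fin n → ℝ) :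
    osc Q z (ξ + v) = osc Q z v * osc Q (z.2 • polarVec Q v + z.1, z.2) ξ := by
  have h : Q (ξ + v) = Q ξ + Q v + polarVec Q v ⬝ᵥ ξ := by
    rw [polarVec_dotProduct, QuadraticMap.polar]; ring
  simp only [osc, ← Complex.exp_add, h, dotProduct_add, add_dotProduct, smul_dotProduct,
    smul_eq_mul]
  congr 1
  push_cast
  ring

lemma fullExt_translate (Q : QuadraticForm ℝ (Fin n → ℝ)) (f : (Fin n → ℝ) → ℂ)
    (v : Fin n → ℝ) (z : (Fin n → ℝ) × ℝ) :
    fullExt Q (fun ξ => f (ξ - v)) z =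
      osc Q z v * fullExt Q f (z.2 • polarVec Q v + z.1, z.2) := by
  rw [fullExt, ← integral_add_right_eq_self _ v, fullExt, ← integral_const_mul]
  refine integral_congr_ae (ae_of_all _ fun ξ => ?_)
  simp only [add_sub_cancel_right, osc_add]
  ring

/-- At each fixed time the shear is a translation in `x`. -/
lemma measurePreserving_shear (w : Fin n → ℝ) :
    MeasurePreserving fun z : (Fin n → ℝ) × ℝ => (z.2 • w + z.1, z.2) := by
  have h : MeasurePreserving (fun z : ℝ × (Fin n → ℝ) => (z.1, z.1 • w + z.2))
      (volume.prod volume) (volume.prod volume) :=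
    (MeasurePreserving.id volume).skew_product (g := fun t x => t • w + x) (by fun_prop)
      (ae_of_all _ fun t => (measurePreserving_add_left volume (t • w)).map_eq)
  exact (Measure.measurePreserving_swap.comp h).comp Measure.measurePreserving_swap

lemma extEnergy_translate (Q : QuadraticForm ℝ (Fin n → ℝ)) (q : ℝ) {f : (Fin n → ℝ) → ℂ}
    (hf : Measurable f) (v : Fin n → ℝ) :
    extEnergy Q q (fun ξ => f (ξ - v)) = extEnergy Q q f := by
  have h1 : ∀ z, ‖fullExt Q (fun ξ => f (ξ - v)) z‖ₑ ^ q =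
      (fun z => ‖fullExt Q f z‖ₑ ^ q) (z.2 • polarVec Q v + z.1, z.2) := by
    intro z
    rw [fullExt_translate, enorm_mul, ← ofReal_norm (osc Q z v), norm_osc, ENNReal.ofReal_one,
      one_mul]
  rw [extEnergy, lintegral_congr h1,
    (measurePreserving_shear (polarVec Q v)).lintegral_comp
      ((stronglyMeasurable_fullExt Q hf).measurable.enorm.pow_const q), extEnergy]

/-- Parabolic scaling: `Q` is homogeneous of degree two, hence the factor `4` in time. -/
lemma fullExt_dilate (Q : QuadraticForm ℝ (Fin n → ℝ)) (f : (Fin n → ℝ) → ℂ)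
    (z : (Fin n → ℝ) × ℝ) :
    fullExt Q f z = (2 : ℂ) ^ n * fullExt Q (fun ξ => f ((2 : ℝ) • ξ))
      ((2 : ℝ) • z.1, (4 : ℝ) * z.2) := by
  have h1 : ∀ ξ, osc Q ((2 : ℝ) • z.1, (4 : ℝ) * z.2) ξ = osc Q z ((2 : ℝ) • ξ) := by
    intro ξ
    simp only [osc, QuadraticMap.map_smul, smul_dotProduct, dotProduct_smul, smul_eq_mul]
    congr 4
    ring
  have h2 := Measure.integral_comp_smul (volume : Measure (Fin n → ℝ))
    (fun ξ => f ξ * osc Q z ξ) (2 : ℝ)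
  simp only [fullExt, h1]
  rw [h2, Module.finrank_fintype_fun_eq_card, Fintype.card_fin, abs_of_pos (by positivity),
    Complex.real_smul]
  push_cast
  rw [mul_inv_cancel_left₀ (pow_ne_zero n two_ne_zero)]

lemma exists_map_dilate : ∃ c : ℝ≥0∞, c ≠ ∞ ∧
    Measure.map (fun z : (Fin n → ℝ) × ℝ => ((2 : ℝ) • z.1, (4 : ℝ) * z.2)) volume =
      c • volume := by
  let L : (Fin n → ℝ) × ℝ →ₗ[ℝ] (Fin n → ℝ) × ℝ :=
    LinearMap.prodMap ((2 : ℝ) • LinearMap.id) ((4 : ℝ) • LinearMap.id)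
  have hL : LinearMap.det L ≠ 0 := by
    rw [LinearMap.det_prodMap]
    simp
  have : (volume : Measure ((Fin n → ℝ) × ℝ)).IsAddHaarMeasure :=
    inferInstanceAs ((volume : Measure (Fin n → ℝ)).prod (volume : Measure ℝ)).IsAddHaarMeasure
  exact ⟨_, ENNReal.ofReal_ne_top, Measure.map_linearMap_addHaar_eq_smul_addHaar volume hL⟩

lemma exists_extEnergy_le_dilate (Q : QuadraticForm ℝ (Fin n → ℝ)) {q : ℝ} (hq : 0 ≤ q) :
    ∃ c : ℝ≥0∞, c ≠ ∞ ∧ ∀ f : (Fin n → ℝ) → ℂ, Measurable f →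
      extEnergy Q q f ≤ c * extEnergy Q q (fun ξ => f ((2 : ℝ) • ξ)) := by
  obtain ⟨c, hc, hmap⟩ := exists_map_dilate (n := n)
  refine ⟨‖(2 : ℂ) ^ n‖ₑ ^ q * c,
    ENNReal.mul_ne_top (ENNReal.rpow_ne_top_of_nonneg hq enorm_ne_top) hc, fun f hf => ?_⟩
  have hm : Measurable fun z => ‖fullExt Q (fun ξ => f ((2 : ℝ) • ξ)) z‖ₑ ^ q :=
    ((stronglyMeasurable_fullExt Q
      (hf.comp (measurable_const_smul (2 : ℝ)))).measurable.enorm.pow_const q)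
  simp only [extEnergy]
  simp_rw [fullExt_dilate Q f, enorm_mul, ENNReal.mul_rpow_of_nonneg _ _ hq]
  have hL : Measurable fun z : (Fin n → ℝ) × ℝ => ((2 : ℝ) • z.1, (4 : ℝ) * z.2) := by fun_prop
  have h := lintegral_map (μ := volume) hm hL
  rw [hmap, lintegral_smul_measure, smul_eq_mul] at h
  rw [mul_assoc, h]
  exact (lintegral_const_mul _ (hm.comp hL)).le

/-! ### Integrability and energy under linear operations -/

lemma integrable_of_bounded_of_support {f : (Fin n → ℝ) → ℂ} (hf : Measurable f) {c : ℝ}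
    (hc : ∀ ξ, ‖f ξ‖ ≤ c) {s : Set (Fin n → ℝ)} (hs : volume s ≠ ∞)
    (hfs : ∀ ξ ∉ s, f ξ = 0) : Integrable f := by
  have h : IntegrableOn f s :=
    IntegrableOn.of_bound hs.lt_top hf.aestronglyMeasurable c (ae_of_all _ hc)
  exact (integrableOn_iff_integrable_of_support_subset
    (fun ξ hξ => by_contra fun h' => hξ (hfs ξ h'))).1 h

lemma volume_Icc_ne_top (a b : Fin n → ℝ) : volume (Set.Icc a b) ≠ ∞ :=
  isCompact_Icc.measure_lt_top.ne

lemma extEnergy_smul (Q : QuadraticForm ℝ (Fin n → ℝ)) {q : ℝ} (hq : 0 ≤ q) (c : ℂ)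
    {f : (Fin n → ℝ) → ℂ} (hf : Measurable f) :
    extEnergy Q q (c • f) = ‖c‖ₑ ^ q * extEnergy Q q f := by
  simp only [extEnergy, fullExt_smul, Pi.smul_apply, smul_eq_mul, enorm_mul,
    ENNReal.mul_rpow_of_nonneg _ _ hq]
  exact lintegral_const_mul _ ((stronglyMeasurable_fullExt Q hf).measurable.enorm.pow_const q)

lemma extEnergy_add_le (Q : QuadraticForm ℝ (Fin n → ℝ)) {q : ℝ} (hq : 1 ≤ q)
    {f g : (Fin n → ℝ) → ℂ} (hf : Measurable f) (hfi : Integrable f) (hgi : Integrable g) :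
    extEnergy Q q (f + g) ≤ 2 ^ (q - 1) * (extEnergy Q q f + extEnergy Q q g) := by
  have hm := (stronglyMeasurable_fullExt Q hf).measurable.enorm.pow_const q
  simp only [extEnergy]
  rw [← lintegral_add_left hm, ← lintegral_const_mul' _ _ (by simp), fullExt_add Q hfi hgi]
  refine lintegral_mono fun z => ?_
  exact (ENNReal.rpow_le_rpow (enorm_add_le _ _) (by linarith)).trans
    (ENNReal.rpow_add_le_mul_rpow_add_rpow _ _ hq)

/-! ### From signed characteristic functions to bounded functions -/

/-- The phase of a complex number, equal to `1` at the origin. -/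
noncomputable def phase (z : ℂ) : ℂ := if z = 0 then 1 else z / (‖z‖ : ℂ)

lemma measurable_phase : Measurable phase :=
  Measurable.ite (measurableSet_singleton 0) measurable_const
    (measurable_id.div (Complex.measurable_ofReal.comp measurable_norm))

lemma norm_phase (z : ℂ) : ‖phase z‖ = 1 := by
  rw [phase]
  split_ifs with h
  · exact norm_one
  · rw [norm_div, Complex.norm_real, norm_norm, div_self (norm_ne_zero_iff.2 h)]

lemma phase_mul_norm (z : ℂ) : phase z * (‖z‖ : ℂ) = z := by
  rw [phase]
  split_ifs with h
  · simp [h]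
  · exact div_mul_cancel₀ _ (by simpa using h)

/-- For `s = ±1` and `|z| ≤ 1`, two unimodular numbers with mean `z`. -/
noncomputable def unimodularPart (s : ℝ) (z : ℂ) : ℂ :=
  phase z * (‖z‖ + (s * √(1 - ‖z‖ ^ 2) : ℝ) * Complex.I)

lemma measurable_unimodularPart (s : ℝ) : Measurable (unimodularPart s) := by
  have := measurable_phase
  unfold unimodularPart
  fun_prop

lemma norm_unimodularPart {s : ℝ} (hs : s ^ 2 = 1) {z : ℂ} (hz : ‖z‖ ≤ 1) :
    ‖unimodularPart s z‖ = 1 := by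
  have h0 : 0 ≤ 1 - ‖z‖ ^ 2 := by nlinarith [norm_nonneg z]
  rw [unimodularPart, norm_mul, norm_phase, one_mul, Complex.norm_add_mul_I, mul_pow, hs,
    Real.sq_sqrt h0]
  simp

lemma unimodularPart_add (z : ℂ) : unimodularPart 1 z + unimodularPart (-1) z = 2 * z := by
  conv_rhs => rw [← phase_mul_norm z]
  simp only [unimodularPart]
  push_cast
  ring

/-- Every point of the closed unit disc is the mean of two unimodular numbers, chosen measurably; so
`f` is the mean of two members of `signedCharFun n`. -/
lemma exists_extEnergy_le_of_signedCharFun (Q : QuadraticForm ℝ (Fin n → ℝ)) {q : ℝ}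
    (hq : 1 ≤ q) {M : ℝ≥0∞} (hM : M ≠ ∞) (h : ∀ g ∈ signedCharFun n, extEnergy Q q g ≤ M) :
    ∃ M' : ℝ≥0∞, M' ≠ ∞ ∧ ∀ f : (Fin n → ℝ) → ℂ, Measurable f → (∀ ξ, ‖f ξ‖ ≤ 1) →
      (∀ ξ ∉ unitCube n, f ξ = 0) → extEnergy Q q f ≤ M' := by
  have hq0 : 0 ≤ q := by linarith
  refine ⟨‖(1 / 2 : ℂ)‖ₑ ^ q * (2 ^ (q - 1) * (M + M)), ?_, fun f hf hf1 hf0 => ?_⟩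
  · refine ENNReal.mul_ne_top (ENNReal.rpow_ne_top_of_nonneg hq0 enorm_ne_top)
      (ENNReal.mul_ne_top ?_ (ENNReal.add_ne_top.2 ⟨hM, hM⟩))
    simp
  let u : ℝ → (Fin n → ℝ) → ℂ := fun s => (unitCube n).indicator fun ξ => unimodularPart s (f ξ)
  have hum : ∀ s, Measurable (u s) := fun s =>
    ((measurable_unimodularPart s).comp hf).indicator measurableSet_unitCube
  have hu0 : ∀ s, ∀ ξ ∉ unitCube n, u s ξ = 0 := fun s ξ hξ => Set.indicator_of_notMem hξ _
  have hu1 : ∀ s : ℝ, s ^ 2 = 1 → ∀ ξ ∈ unitCube n, ‖u s ξ‖ = 1 := fun s hs ξ hξ => by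
    simp only [u, Set.indicator_of_mem hξ]
    exact norm_unimodularPart hs (hf1 ξ)
  have hub : ∀ s : ℝ, s ^ 2 = 1 → ∀ ξ, ‖u s ξ‖ ≤ 1 := fun s hs ξ => by
    by_cases hξ : ξ ∈ unitCube n
    · exact (hu1 s hs ξ hξ).le
    · simp [hu0 s ξ hξ]
  have hui : ∀ s : ℝ, s ^ 2 = 1 → Integrable (u s) := fun s hs =>
    integrable_of_bounded_of_support (hum s) (hub s hs) (volume_Icc_ne_top 0 1) (hu0 s)
  have hE : ∀ s : ℝ, s ^ 2 = 1 → extEnergy Q q (u s) ≤ M := fun s hs =>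
    h _ ⟨hum s, fun ξ hξ => Or.inr (hu1 s hs ξ hξ), hu0 s⟩
  have hfu : f = (1 / 2 : ℂ) • (u 1 + u (-1)) := by
    ext ξ
    by_cases hξ : ξ ∈ unitCube n
    · simp only [u, Pi.smul_apply, Pi.add_apply, Set.indicator_of_mem hξ, unimodularPart_add,
        smul_eq_mul]
      ring
    · simp [hu0 _ ξ hξ, hf0 ξ hξ]
  rw [hfu, extEnergy_smul Q hq0 _ ((hum 1).add (hum (-1)))]
  gcongr
  refine (extEnergy_add_le Q hq (hum 1) (hui 1 (by norm_num)) (hui (-1) (by norm_num))).trans ?_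
  gcongr
  · exact hE 1 (by norm_num)
  · exact hE (-1) (by norm_num)

/-- Translates of subsets of the cube by vectors of the cube lie in `[0,2]^n`; scaling by two brings
the packed functions back to the cube. -/
lemma exists_extEnergy_le_of_support_double (Q : QuadraticForm ℝ (Fin n → ℝ)) {q : ℝ}
    (hq : 0 ≤ q) {M : ℝ≥0∞} (hM : M ≠ ∞)
    (h : ∀ f : (Fin n → ℝ) → ℂ, Measurable f → (∀ ξ, ‖f ξ‖ ≤ 1) →
      (∀ ξ ∉ unitCube n, f ξ = 0) → extEnergy Q q f ≤ M) :
    ∃ M' : ℝ≥0∞, M' ≠ ∞ ∧ ∀ f : (Fin n → ℝ) → ℂ, Measurable f → (∀ ξ, ‖f ξ‖ ≤ 1) →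
      (∀ ξ ∉ Set.Icc (0 : Fin n → ℝ) 2, f ξ = 0) → extEnergy Q q f ≤ M' := by
  obtain ⟨c, hc, hcf⟩ := exists_extEnergy_le_dilate Q hq
  refine ⟨c * M, ENNReal.mul_ne_top hc hM, fun f hf hf1 hf0 => (hcf f hf).trans ?_⟩
  gcongr
  refine h _ (hf.comp (measurable_const_smul (2 : ℝ))) (fun ξ => hf1 _) fun ξ hξ => hf0 _ ?_
  contrapose! hξ
  refine ⟨fun i => ?_, fun i => ?_⟩
  · have := hξ.1 i
    simp only [Pi.zero_apply, Pi.smul_apply, smul_eq_mul] at this ⊢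
    linarith
  · have := hξ.2 i
    simp only [Pi.smul_apply, smul_eq_mul, Pi.ofNat_apply] at this ⊢
    linarith

/-! ### Superadditivity of the energy for a suitable sign -/

/-- A Clarkson inequality: the parallelogram law for the squares, combined with superadditivity and
convexity of `x ↦ x^(q/2)`, which need `q ≥ 2`. -/
lemma two_mul_enorm_rpow_add_le {q : ℝ} (hq : 2 ≤ q) (a b : ℂ) :
    2 * (‖a‖ₑ ^ q + ‖b‖ₑ ^ q) ≤ ‖a + b‖ₑ ^ q + ‖a - b‖ₑ ^ q := by
  have hs : 1 ≤ q / 2 := by linarith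
  have hpow : ∀ x : ℝ≥0, x ^ q = (x ^ 2) ^ (q / 2) := fun x => by
    rw [← NNReal.rpow_natCast, ← NNReal.rpow_mul]
    congr 1
    push_cast
    ring
  have hpar : ‖a‖₊ ^ 2 + ‖b‖₊ ^ 2 = 1 / 2 * ‖a + b‖₊ ^ 2 + 1 / 2 * ‖a - b‖₊ ^ 2 := by
    have := parallelogram_law_with_norm ℝ a b
    rw [← NNReal.coe_inj]
    push_cast
    nlinarith
  have h1 := NNReal.add_rpow_le_rpow_add (‖a‖₊ ^ 2) (‖b‖₊ ^ 2) hs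
  rw [hpar] at h1
  have h2 := h1.trans (NNReal.rpow_arith_mean_le_arith_mean2_rpow (1 / 2) (1 / 2) (‖a + b‖₊ ^ 2)
    (‖a - b‖₊ ^ 2) (add_halves 1) hs)
  simp only [← hpow] at h2
  have h3 : 2 * (‖a‖₊ ^ q + ‖b‖₊ ^ q) ≤ ‖a + b‖₊ ^ q + ‖a - b‖₊ ^ q := by
    calc 2 * (‖a‖₊ ^ q + ‖b‖₊ ^ q)
        ≤ 2 * (1 / 2 * ‖a + b‖₊ ^ q + 1 / 2 * ‖a - b‖₊ ^ q) := by gcongr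
      _ = _ := by rw [mul_add, ← mul_assoc, ← mul_assoc]; norm_num
  have hq0 : 0 ≤ q := by linarith
  simp only [enorm_eq_nnnorm, ← ENNReal.coe_rpow_of_nonneg _ hq0]
  exact_mod_cast h3

/-- Integrating the Clarkson inequality bounds the mean over `s = ±1` from below, and one sign does
at least as well as the mean. -/
lemma exists_sign_extEnergy_add_le (Q : QuadraticForm ℝ (Fin n → ℝ)) {q : ℝ} (hq : 2 ≤ q)
    {f g : (Fin n → ℝ) → ℂ} (hf : Measurable f) (hg : Measurable g) (hfi : Integrable f)
    (hgi : Integrable g) :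
    ∃ s : ℂ, ‖s‖ = 1 ∧ extEnergy Q q f + extEnergy Q q g ≤ extEnergy Q q (f + s • g) := by
  have hm : ∀ {f : (Fin n → ℝ) → ℂ}, Measurable f → Measurable fun z => ‖fullExt Q f z‖ₑ ^ q :=
    fun hf => (stronglyMeasurable_fullExt Q hf).measurable.enorm.pow_const q
  have key : 2 * (extEnergy Q q f + extEnergy Q q g) ≤
      extEnergy Q q (f + (1 : ℂ) • g) + extEnergy Q q (f + (-1 : ℂ) • g) := by
    simp only [extEnergy]
    rw [← lintegral_add_left (hm hf), ← lintegral_const_mul' _ _ ENNReal.ofNat_ne_top,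
      ← lintegral_add_left (hm (hf.add (hg.const_smul _)))]
    refine lintegral_mono fun z => ?_
    rw [fullExt_add Q hfi (hgi.smul _), fullExt_add Q hfi (hgi.smul _), fullExt_smul, fullExt_smul]
    simpa [sub_eq_add_neg] using two_mul_enorm_rpow_add_le hq (fullExt Q f z) (fullExt Q g z)
  by_contra! hcon
  have h1 := hcon 1 norm_one
  have h2 := hcon (-1) (by simp)
  have h3 := ENNReal.add_lt_add h1 h2
  rw [← two_mul] at h3
  exact absurd key h3.not_ge

/-! ### Moving a function off an occupied set -/

lemma rpow_lintegral_enorm_le {α : Type*} [MeasurableSpace α] {μ : Measure α}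
    [IsProbabilityMeasure μ] {q : ℝ} (hq : 1 ≤ q) {f : α → ℂ} (hf : AEStronglyMeasurable f μ) :
    (∫⁻ a, ‖f a‖ₑ ∂μ) ^ q ≤ ∫⁻ a, ‖f a‖ₑ ^ q ∂μ := by
  have h := eLpNorm'_le_eLpNorm'_of_exponent_le one_pos hq μ hf
  simp only [eLpNorm', ENNReal.rpow_one, div_one] at h
  have hq0 : 0 < q := by linarith
  calc (∫⁻ a, ‖f a‖ₑ ∂μ) ^ q ≤ ((∫⁻ a, ‖f a‖ₑ ^ q ∂μ) ^ (1 / q)) ^ q :=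
        ENNReal.rpow_le_rpow h hq0.le
    _ = _ := by rw [← ENNReal.rpow_mul, one_div_mul_cancel hq0.ne', ENNReal.rpow_one]

/-- The proportion of `v ∈ Ω` for which `ξ + v` avoids `B`. -/
noncomputable def avoidProb (B : Set (Fin n → ℝ)) (ξ : Fin n → ℝ) : ℝ :=
  ∫ v, Bᶜ.indicator (fun _ => (1 : ℝ)) (ξ + v) ∂quadricMeasure n

lemma measurable_avoidProb {B : Set (Fin n → ℝ)} (hB : MeasurableSet B) :
    Measurable (avoidProb B) := by
  refine (StronglyMeasurable.integral_prod_right (ν := quadricMeasure n)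
    (f := fun ξ v => Bᶜ.indicator (fun _ => (1 : ℝ)) (ξ + v)) ?_).measurable
  exact ((measurable_const.indicator hB.compl).comp
    (measurable_fst.add measurable_snd)).stronglyMeasurable

/-- The bad `v` form a translate of `B`, of measure at most `1/2`, while the cube has measure one.
-/
lemma half_le_avoidProb {B : Set (Fin n → ℝ)} (hB : MeasurableSet B) (hvol : volume B ≤ 1 / 2)
    (ξ : Fin n → ℝ) : 1 / 2 ≤ avoidProb B ξ := by
  have hS : MeasurableSet ((fun v => ξ + v) ⁻¹' B) := measurable_const_add ξ hB
  have h1 : avoidProb B ξ = (quadricMeasure n).real ((fun v => ξ + v) ⁻¹' B)ᶜ := by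
    rw [← integral_indicator_one hS.compl]
    rfl
  have h2 : quadricMeasure n ((fun v => ξ + v) ⁻¹' B) ≤ 1 / 2 :=
    ((Measure.restrict_apply_le _ _).trans (measure_preimage_add volume ξ B).le).trans hvol
  have h3 : (quadricMeasure n).real ((fun v => ξ + v) ⁻¹' B) ≤ 1 / 2 := by
    have := ENNReal.toReal_mono (by simp) h2
    simpa [Measure.real] using this
  rw [h1, probReal_compl_eq_one_sub hS]
  linarith

/-- A function that is twice an average of a family over the unit cube has at most `2 ^ q` times
the energy of some member of the family. -/
lemma exists_extEnergy_le_of_average (Q : QuadraticForm ℝ (Fin n → ℝ)) {q : ℝ} (hq : 1 ≤ q)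
    {M : ℝ≥0∞} (hM : M ≠ ∞) {A : Set (Fin n → ℝ)} (hA : MeasurableSet A) (hAu : A ⊆ unitCube n)
    {f : (Fin n → ℝ) → ℂ} {F : (Fin n → ℝ) → (Fin n → ℝ) → ℂ}
    (hF : Measurable (Function.uncurry F)) (hF1 : ∀ v ξ, ‖F v ξ‖ ≤ 1)
    (hFA : ∀ v, ∀ ξ ∉ A, F v ξ = 0)
    (hFf : ∀ ξ, ∫ v, F v ξ ∂quadricMeasure n = (1 / 2 : ℂ) * f ξ)
    (h : ∀ v, extEnergy Q q (F v) ≤ M) :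
    ∃ v ∈ unitCube n, extEnergy Q q f ≤ 2 ^ q * extEnergy Q q (F v) := by
  have hq0 : 0 ≤ q := by linarith
  have hEF : Measurable fun w : (Fin n → ℝ) × ((Fin n → ℝ) × ℝ) => fullExt Q (F w.1) w.2 := by
    refine (StronglyMeasurable.integral_prod_right
      (f := fun (w : (Fin n → ℝ) × ((Fin n → ℝ) × ℝ)) ξ => F w.1 ξ * osc Q w.2 ξ) ?_).measurable
    refine Measurable.stronglyMeasurable ?_
    have hm1 : Measurable fun w : ((Fin n → ℝ) × ((Fin n → ℝ) × ℝ)) × (Fin n → ℝ) =>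
        (w.1.1, w.2) := by fun_prop
    have hm2 : Measurable fun w : ((Fin n → ℝ) × ((Fin n → ℝ) × ℝ)) × (Fin n → ℝ) =>
        (w.1.2, w.2) := by fun_prop
    have h1 := hF.comp hm1
    have h2 := (continuous_osc Q).measurable.comp hm2
    exact h1.mul h2
  have havg : ∀ z, ∫ v, fullExt Q (F v) z ∂quadricMeasure n = (1 / 2 : ℂ) * fullExt Q f z := by
    intro z
    have hint : Integrable (Function.uncurry fun v ξ => F v ξ * osc Q z ξ)
        ((quadricMeasure n).prod volume) := by
      have hdom : Integrable (fun w : (Fin n → ℝ) × (Fin n → ℝ) =>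
          A.indicator (fun _ => (1 : ℝ)) w.2) ((quadricMeasure n).prod volume) := by
        refine Integrable.comp_snd (f := A.indicator fun _ => (1 : ℝ)) ?_ (quadricMeasure n)
        exact (integrable_indicator_iff hA).2 (integrableOn_const
          (volume_ne_top_of_subset_unitCube hAu))
      refine hdom.mono' ?_ (ae_of_all _ fun w => ?_)
      · exact (hF.mul ((continuous_osc_right Q z).measurable.comp
          measurable_snd)).aestronglyMeasurable
      · simp only [Function.uncurry, norm_mul, norm_osc, mul_one]
        by_cases hw : w.2 ∈ A
        · rw [Set.indicator_of_mem hw]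
          exact hF1 _ _
        · rw [Set.indicator_of_notMem hw, hFA _ _ hw, norm_zero]
    simp only [fullExt]
    rw [integral_integral_swap hint, ← integral_const_mul]
    refine integral_congr_ae (ae_of_all _ fun ξ => ?_)
    change ∫ v, F v ξ * osc Q z ξ ∂quadricMeasure n = 1 / 2 * (f ξ * osc Q z ξ)
    rw [integral_mul_const, hFf, mul_assoc]
  have henergy : ∀ z, ‖fullExt Q f z‖ₑ ^ q ≤
      2 ^ q * ∫⁻ v, ‖fullExt Q (F v) z‖ₑ ^ q ∂quadricMeasure n := by
    intro z
    have h1 : fullExt Q f z = 2 * ∫ v, fullExt Q (F v) z ∂quadricMeasure n := by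
      rw [havg]; ring
    have h2 : ‖(2 : ℂ)‖ₑ = 2 := by
      rw [← ofReal_norm]; simp
    rw [h1, enorm_mul, h2, ENNReal.mul_rpow_of_nonneg _ _ hq0]
    gcongr
    refine (ENNReal.rpow_le_rpow (enorm_integral_le_lintegral_enorm _) hq0).trans ?_
    exact rpow_lintegral_enorm_le hq (hEF.comp measurable_prodMk_right).aestronglyMeasurable
  have hfubini : extEnergy Q q f ≤ 2 ^ q * ∫⁻ v, extEnergy Q q (F v) ∂quadricMeasure n := by
    calc extEnergy Q q f
        ≤ ∫⁻ z, 2 ^ q * ∫⁻ v, ‖fullExt Q (F v) z‖ₑ ^ q ∂quadricMeasure n :=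
          lintegral_mono henergy
      _ = 2 ^ q * ∫⁻ z, ∫⁻ v, ‖fullExt Q (F v) z‖ₑ ^ q ∂quadricMeasure n :=
          lintegral_const_mul' _ _ (ENNReal.rpow_ne_top_of_nonneg hq0 (by simp))
      _ = _ := by
          rw [lintegral_lintegral_swap]
          · rfl
          · exact ((hEF.comp measurable_swap).enorm.pow_const q).aemeasurable
  -- Finiteness is needed to pick a `v` whose energy is at least the average.
  have hfin : ∫⁻ v, extEnergy Q q (F v) ∂quadricMeasure n ≠ ∞ := by
    refine ((lintegral_mono fun v => h v).trans_lt ?_).ne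
    simpa using hM.lt_top
  -- The selected `v` must lie in the cube itself, so that translates by it stay in `[0,2]^n`.
  have hnull : quadricMeasure n (unitCube n)ᶜ = 0 := by
    rw [quadricMeasure, Measure.restrict_apply measurableSet_unitCube.compl]
    simp
  obtain ⟨v, hv, hvE⟩ := exists_notMem_null_lintegral_le hfin hnull
  rw [Set.mem_compl_iff, not_not] at hv
  exact ⟨v, hv, hfubini.trans (by gcongr)⟩

/-- Cutting off outside `B` after translation by `v` multiplies `f` by the indicator of `ξ + v ∉ B`.
Its mean over `v` is `avoidProb B ξ`, so dividing `f` beforehand by `2 * avoidProb B` makes the mean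
exactly `f / 2`. Since this probability is at least `1/2`, the divided function is still bounded by
one. -/
lemma exists_extEnergy_disjoint_translate (Q : QuadraticForm ℝ (Fin n → ℝ)) {q : ℝ} (hq : 1 ≤ q)
    {M : ℝ≥0∞} (hM : M ≠ ∞)
    (h : ∀ f : (Fin n → ℝ) → ℂ, Measurable f → (∀ ξ, ‖f ξ‖ ≤ 1) →
      (∀ ξ ∉ Set.Icc (0 : Fin n → ℝ) 2, f ξ = 0) → extEnergy Q q f ≤ M)
    {A B : Set (Fin n → ℝ)} (hA : MeasurableSet A) (hAu : A ⊆ unitCube n) (hB : MeasurableSet B)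
    (hvol : volume B ≤ 1 / 2) {f : (Fin n → ℝ) → ℂ} (hf : Measurable f) (hf1 : ∀ ξ, ‖f ξ‖ ≤ 1)
    (hfA : ∀ ξ ∉ A, f ξ = 0) :
    ∃ (g : (Fin n → ℝ) → ℂ) (A' : Set (Fin n → ℝ)), Measurable g ∧ (∀ ξ, ‖g ξ‖ ≤ 1) ∧
      MeasurableSet A' ∧ A' ⊆ Set.Icc 0 2 ∧ volume A' ≤ volume A ∧ Disjoint A' B ∧
      (∀ ξ ∉ A', g ξ = 0) ∧ extEnergy Q q f ≤ 2 ^ q * extEnergy Q q g := by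
  have hP := measurable_avoidProb hB
  have hP2 : ∀ ξ, 0 < avoidProb B ξ := fun ξ => by linarith [half_le_avoidProb hB hvol ξ]
  let k : (Fin n → ℝ) → ℂ := fun ξ => f ξ * ((2 * avoidProb B ξ)⁻¹ : ℝ)
  have hk : Measurable k := hf.mul (Complex.measurable_ofReal.comp (hP.const_mul 2).inv)
  have hk1 : ∀ ξ, ‖k ξ‖ ≤ 1 := fun ξ => by
    have h1 : (2 * avoidProb B ξ)⁻¹ ≤ 1 :=
      inv_le_one_of_one_le₀ (by linarith [half_le_avoidProb hB hvol ξ])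
    have h0 : 0 ≤ (2 * avoidProb B ξ)⁻¹ := inv_nonneg.2 (by linarith [hP2 ξ])
    rw [norm_mul, Complex.norm_real, Real.norm_of_nonneg h0]
    exact mul_le_one₀ (hf1 ξ) h0 h1
  let χ : (Fin n → ℝ) → ℝ := Bᶜ.indicator fun _ => (1 : ℝ)
  have hχ : Measurable χ := measurable_const.indicator hB.compl
  have hχ1 : ∀ ξ, ‖χ ξ‖ ≤ 1 := fun ξ => by
    by_cases hξ : ξ ∈ Bᶜ
    · simp [χ, Set.indicator_of_mem hξ]
    · simp [χ, Set.indicator_of_notMem hξ]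
  let F : (Fin n → ℝ) → (Fin n → ℝ) → ℂ := fun v ξ => k ξ * (χ (ξ + v) : ℂ)
  have hF : Measurable (Function.uncurry F) :=
    (hk.comp measurable_snd).mul (Complex.measurable_ofReal.comp
      (hχ.comp (measurable_snd.add measurable_fst)))
  have hFv : ∀ v, Measurable (F v) := fun v => hF.comp measurable_prodMk_left
  have hF1 : ∀ v ξ, ‖F v ξ‖ ≤ 1 := fun v ξ => by
    rw [norm_mul, Complex.norm_real]
    exact mul_le_one₀ (hk1 ξ) (norm_nonneg _) (hχ1 _)
  have hFA : ∀ v, ∀ ξ ∉ A, F v ξ = 0 := fun v ξ hξ => by simp [F, k, hfA ξ hξ]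
  have hF2 : ∀ v, ∀ ξ ∉ Set.Icc (0 : Fin n → ℝ) 2, F v ξ = 0 := fun v ξ hξ =>
    hFA v ξ fun hξA => hξ ⟨(hAu hξA).1, (hAu hξA).2.trans (fun i => by simp)⟩
  have hFf : ∀ ξ, ∫ v, F v ξ ∂quadricMeasure n = (1 / 2 : ℂ) * f ξ := fun ξ => by
    have h1 : ∫ v, (χ (ξ + v) : ℂ) ∂quadricMeasure n = (avoidProb B ξ : ℂ) := integral_complex_ofReal
    have h2 : (avoidProb B ξ : ℂ) ≠ 0 := Complex.ofReal_ne_zero.2 (hP2 ξ).ne'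
    simp only [F]
    rw [integral_const_mul, h1]
    simp only [k]
    push_cast
    field_simp
  obtain ⟨v, hv, hvE⟩ := exists_extEnergy_le_of_average Q hq hM hA hAu hF hF1 hFA hFf
    fun v => h (F v) (hFv v) (hF1 v) (hF2 v)
  refine ⟨fun ξ => F v (ξ - v), ((fun ξ => ξ - v) ⁻¹' A) ∩ Bᶜ,
    (hFv v).comp (measurable_sub_const v), fun ξ => hF1 v _,
    (measurable_sub_const v hA).inter hB.compl, ?_, ?_, ?_, ?_, ?_⟩
  · rintro ξ ⟨hξ, -⟩
    have h1 := hAu hξ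
    refine ⟨fun i => ?_, fun i => ?_⟩
    · have a := h1.1 i
      have b := hv.1 i
      simp only [Pi.zero_apply, Pi.sub_apply] at a b ⊢
      linarith
    · have a := h1.2 i
      have b := hv.2 i
      simp only [Pi.sub_apply, Pi.ofNat_apply] at a b ⊢
      linarith
  · exact (measure_mono Set.inter_subset_left).trans
      ((measurePreserving_sub_right volume v).measure_preimage hA.nullMeasurableSet).le
  · exact Set.disjoint_left.2 fun ξ hξ => hξ.2
  · intro ξ hξ
    by_cases hξA : ξ - v ∈ A
    · have hξB : ξ ∉ Bᶜ := fun hb => hξ ⟨hξA, hb⟩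
      simp [F, χ, Set.indicator_of_notMem hξB]
    · exact hFA v _ hξA
  · rw [extEnergy_translate Q q (hFv v) v]
    exact hvE

/-! ### Packing and the restricted strong type estimate -/

/-- Greedy construction of `N + 1` pieces. Room is needed only before the last placement, when the
occupied set has measure at most `N * volume A`; hence the bound in `hN`. Each piece is made from
`f` afresh, so the loss `2 ^ q` does not compound. -/
lemma exists_packing (Q : QuadraticForm ℝ (Fin n → ℝ)) {q : ℝ} (hq : 2 ≤ q)
    {M : ℝ≥0∞} (hM : M ≠ ∞)
    (h : ∀ f : (Fin n → ℝ) → ℂ, Measurable f → (∀ ξ, ‖f ξ‖ ≤ 1) →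
      (∀ ξ ∉ Set.Icc (0 : Fin n → ℝ) 2, f ξ = 0) → extEnergy Q q f ≤ M)
    {A : Set (Fin n → ℝ)} (hA : MeasurableSet A) (hAu : A ⊆ unitCube n)
    {f : (Fin n → ℝ) → ℂ} (hf : Measurable f) (hf1 : ∀ ξ, ‖f ξ‖ ≤ 1)
    (hfA : ∀ ξ ∉ A, f ξ = 0) (N : ℕ) (hN : N * volume A ≤ 1 / 2) :
    ∃ (H : (Fin n → ℝ) → ℂ) (B : Set (Fin n → ℝ)), Measurable H ∧ (∀ ξ, ‖H ξ‖ ≤ 1) ∧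
      MeasurableSet B ∧ B ⊆ Set.Icc 0 2 ∧ volume B ≤ (N + 1 : ℕ) * volume A ∧
      (∀ ξ ∉ B, H ξ = 0) ∧ (N + 1 : ℕ) * extEnergy Q q f ≤ 2 ^ q * extEnergy Q q H := by
  induction N with
  | zero =>
    refine ⟨f, A, hf, hf1, hA, fun ξ hξ => ⟨(hAu hξ).1, (hAu hξ).2.trans (fun i => by simp)⟩,
      by simp, hfA, ?_⟩
    gcongr
    simpa using ENNReal.one_le_rpow (by norm_num : (1 : ℝ≥0∞) ≤ 2) (by linarith : 0 < q)
  | succ N ih =>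
    obtain ⟨H, B, hH, hH1, hB, hB2, hBvol, hHB, hHE⟩ := ih (le_trans (by gcongr; simp) hN)
    obtain ⟨g, A', hg, hg1, hA', hA'2, hA'vol, hdisj, hgA', hgE⟩ :=
      exists_extEnergy_disjoint_translate Q (by linarith) hM h hA hAu hB (hBvol.trans hN) hf hf1 hfA
    obtain ⟨s, hs, hsE⟩ := exists_sign_extEnergy_add_le Q hq hH hg
      (integrable_of_bounded_of_support hH hH1 (volume_Icc_ne_top 0 2)
        fun ξ hξ => hHB ξ fun h' => hξ (hB2 h'))
      (integrable_of_bounded_of_support hg hg1 (volume_Icc_ne_top 0 2)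
        fun ξ hξ => hgA' ξ fun h' => hξ (hA'2 h'))
    -- Disjointness of `B` and `A'` keeps the sum bounded by one.
    refine ⟨H + s • g, B ∪ A', hH.add (hg.const_smul s), fun ξ => ?_, hB.union hA',
      Set.union_subset hB2 hA'2, ?_, fun ξ hξ => ?_, ?_⟩
    · by_cases hξ : ξ ∈ B
      · simpa [hgA' ξ (Set.disjoint_right.1 hdisj hξ)] using hH1 ξ
      · simpa [hHB ξ hξ, hs] using hg1 ξ
    · refine (measure_union_le _ _).trans ?_
      rw [Nat.cast_succ (N + 1), add_mul, one_mul]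
      gcongr
    · rw [Set.mem_union, not_or] at hξ
      simp [hHB ξ hξ.1, hgA' ξ hξ.2]
    · calc ((N + 1 + 1 : ℕ) : ℝ≥0∞) * extEnergy Q q f
          = (N + 1 : ℕ) * extEnergy Q q f + extEnergy Q q f := by
            rw [Nat.cast_succ (N + 1), add_mul, one_mul]
        _ ≤ 2 ^ q * extEnergy Q q H + 2 ^ q * extEnergy Q q g := add_le_add hHE hgE
        _ = 2 ^ q * (extEnergy Q q H + extEnergy Q q g) := (mul_add _ _ _).symm
        _ ≤ _ := by gcongr

/-- The restricted strong type estimate at the exponent `q`. -/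
lemma extEnergy_le_volume (Q : QuadraticForm ℝ (Fin n → ℝ)) {q : ℝ} (hq : 2 ≤ q)
    {M : ℝ≥0∞} (hM : M ≠ ∞)
    (h : ∀ f : (Fin n → ℝ) → ℂ, Measurable f → (∀ ξ, ‖f ξ‖ ≤ 1) →
      (∀ ξ ∉ Set.Icc (0 : Fin n → ℝ) 2, f ξ = 0) → extEnergy Q q f ≤ M)
    {A : Set (Fin n → ℝ)} (hA : MeasurableSet A) (hAu : A ⊆ unitCube n)
    {f : (Fin n → ℝ) → ℂ} (hf : Measurable f) (hf1 : ∀ ξ, ‖f ξ‖ ≤ 1)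
    (hfA : ∀ ξ ∉ A, f ξ = 0) :
    extEnergy Q q f ≤ 2 * (2 ^ q * M) * volume A := by
  have hA1 : volume A ≠ ∞ := volume_ne_top_of_subset_unitCube hAu
  have key : ∀ N : ℕ, N * volume A ≤ 1 / 2 → (N + 1 : ℕ) * extEnergy Q q f ≤ 2 ^ q * M := by
    intro N hN
    obtain ⟨H, B, hH, hH1, -, hB2, -, hHB, hHE⟩ := exists_packing Q hq hM h hA hAu hf hf1 hfA N hN
    refine hHE.trans ?_
    gcongr
    exact h H hH hH1 fun ξ hξ => hHB ξ fun h' => hξ (hB2 h')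
  rcases eq_or_ne (volume A) 0 with h0 | h0
  · have hf0 : fullExt Q f = 0 := fullExt_eq_zero_of_ae Q <| by
      filter_upwards [measure_eq_zero_iff_ae_notMem.1 h0] with ξ hξ
      exact hfA ξ hξ
    simp [extEnergy, hf0, ENNReal.zero_rpow_of_pos (by linarith : 0 < q)]
  · have hr : 0 < (volume A).toReal := ENNReal.toReal_pos h0 hA1
    set r := (volume A).toReal
    have hAr : volume A = ENNReal.ofReal r := (ENNReal.ofReal_toReal hA1).symm
    -- The largest `N` allowed by the packing; maximality gives `N + 1 ≥ 1 / (2 * r)`, which turns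
    -- the bound into a multiple of `volume A`.
    set N := ⌊1 / (2 * r)⌋₊
    have hN1 : (N : ℝ) * r ≤ 1 / 2 := by
      have := Nat.floor_le (by positivity : 0 ≤ 1 / (2 * r))
      calc (N : ℝ) * r ≤ 1 / (2 * r) * r := by gcongr
        _ = 1 / 2 := by field_simp
    have hN2 : 1 ≤ 2 * r * (N + 1 : ℕ) := by
      have := Nat.lt_floor_add_one (1 / (2 * r))
      rw [div_lt_iff₀ (by positivity)] at this
      push_cast
      linarith
    have hN1' : N * volume A ≤ 1 / 2 := by
      rw [hAr, ← ENNReal.ofReal_natCast, ← ENNReal.ofReal_mul (by positivity)]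
      refine (ENNReal.ofReal_le_ofReal hN1).trans_eq ?_
      rw [ENNReal.ofReal_div_of_pos two_pos]
      simp
    have hN2' : 1 ≤ 2 * volume A * (N + 1 : ℕ) := by
      have := ENNReal.ofReal_le_ofReal hN2
      rwa [ENNReal.ofReal_mul (by positivity), ENNReal.ofReal_mul zero_le_two,
        ENNReal.ofReal_natCast, ← hAr, ENNReal.ofReal_one, ENNReal.ofReal_ofNat] at this
    calc extEnergy Q q f = 1 * extEnergy Q q f := (one_mul _).symm
      _ ≤ 2 * volume A * (N + 1 : ℕ) * extEnergy Q q f := by gcongr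
      _ = 2 * volume A * ((N + 1 : ℕ) * extEnergy Q q f) := mul_assoc _ _ _
      _ ≤ 2 * volume A * (2 ^ q * M) := by exact mul_le_mul_right (key N hN1') _
      _ = _ := by ring

/-! ### Raising the exponent with the sup bound -/

lemma eLpNorm_fullExt_eq (Q : QuadraticForm ℝ (Fin n → ℝ)) {p : ℝ≥0∞} (hp0 : p ≠ 0)
    (hp : p ≠ ∞) (f : (Fin n → ℝ) → ℂ) :
    eLpNorm (fullExt Q f) p volume = extEnergy Q p.toReal f ^ (1 / p.toReal) :=
  eLpNorm_eq_lintegral_rpow_enorm_toReal hp0 hp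

/-- Pointwise `|𝓔f| ≤ |A|`, used for the surplus power `p - q`. -/
lemma extEnergy_le_of_le (Q : QuadraticForm ℝ (Fin n → ℝ)) {q p : ℝ} (hq : 0 ≤ q) (hqp : q ≤ p)
    {A : Set (Fin n → ℝ)} (hA : MeasurableSet A) (hAu : A ⊆ unitCube n)
    {f : (Fin n → ℝ) → ℂ} (hf1 : ∀ ξ, ‖f ξ‖ ≤ 1)
    (hfA : ∀ ξ ∉ A, f ξ = 0) :
    extEnergy Q p f ≤ volume A ^ (p - q) * extEnergy Q q f := by
  have hsup : ∀ z, ‖fullExt Q f z‖ₑ ≤ volume A := fun z => by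
    refine (enorm_fullExt_le Q f z).trans ?_
    rw [← lintegral_indicator_one hA]
    refine lintegral_mono fun ξ => ?_
    by_cases hξ : ξ ∈ A
    · rw [Set.indicator_of_mem hξ, ← ofReal_norm]
      exact ENNReal.ofReal_le_one.2 (hf1 ξ)
    · simp [hfA ξ hξ]
  rw [extEnergy, extEnergy, ← lintegral_const_mul' _ _
    (ENNReal.rpow_ne_top_of_nonneg (by linarith) (volume_ne_top_of_subset_unitCube hAu))]
  refine lintegral_mono fun z => ?_
  have h : ‖fullExt Q f z‖ₑ ^ p = ‖fullExt Q f z‖ₑ ^ (p - q) * ‖fullExt Q f z‖ₑ ^ q := by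
    rw [← ENNReal.rpow_add_of_nonneg _ _ (by linarith) hq, sub_add_cancel]
  rw [h]
  gcongr
  exact hsup z

/-- A restricted strong type estimate for bounded functions supported in subsets of the cube. -/
def RestrictedBound (Q : QuadraticForm ℝ (Fin n → ℝ)) (q : ℝ) (K : ℝ≥0∞) : Prop :=
  ∀ A : Set (Fin n → ℝ), MeasurableSet A → A ⊆ unitCube n → ∀ f : (Fin n → ℝ) → ℂ,
    Measurable f → (∀ ξ, ‖f ξ‖ ≤ 1) → (∀ ξ ∉ A, f ξ = 0) → extEnergy Q q f ≤ K * volume A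

lemma RestrictedBound.eLpNorm_le {Q : QuadraticForm ℝ (Fin n → ℝ)} {q : ℝ} {K : ℝ≥0∞}
    (hK : RestrictedBound Q q K) (hq : 0 < q) {p : ℝ≥0∞} (hp : p ≠ ∞) (hqp : q < p.toReal)
    {A : Set (Fin n → ℝ)} (hA : MeasurableSet A) (hAu : A ⊆ unitCube n) {f : (Fin n → ℝ) → ℂ}
    (hf : Measurable f) {c : ℝ} (hc : 0 < c) (hfc : ∀ ξ, ‖f ξ‖ ≤ c) (hfA : ∀ ξ ∉ A, f ξ = 0) :
    eLpNorm (fullExt Q f) p volume ≤ ENNReal.ofReal c *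
      (K ^ (1 / p.toReal) * volume A ^ ((1 + (p.toReal - q)) / p.toReal)) := by
  have hp0 : p ≠ 0 := by rintro rfl; simp at hqp; linarith
  have hpr : 0 < p.toReal := hq.trans hqp
  set g : (Fin n → ℝ) → ℂ := ((c⁻¹ : ℝ) : ℂ) • f with hg
  have hgm : Measurable g := hf.const_smul _
  have hg1 : ∀ ξ, ‖g ξ‖ ≤ 1 := fun ξ => by
    rw [hg, Pi.smul_apply, norm_smul, Complex.norm_real, Real.norm_of_nonneg (by positivity),
      inv_mul_le_one₀ hc]
    exact hfc ξ
  have hgA : ∀ ξ ∉ A, g ξ = 0 := fun ξ hξ => by simp [hg, hfA ξ hξ]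
  have hfg : f = (c : ℂ) • g := by
    rw [hg, smul_smul, ← Complex.ofReal_mul, mul_inv_cancel₀ hc.ne', Complex.ofReal_one, one_smul]
  have hcn : ‖(c : ℂ)‖ₑ = ENNReal.ofReal c := by
    rw [← ofReal_norm, Complex.norm_real, Real.norm_of_nonneg hc.le]
  rw [hfg, fullExt_smul, eLpNorm_const_smul, hcn]
  gcongr
  rw [eLpNorm_fullExt_eq Q hp0 hp]
  have h1 : extEnergy Q p.toReal g ≤ K * volume A ^ (1 + (p.toReal - q)) := by
    refine (extEnergy_le_of_le Q hq.le hqp.le hA hAu hg1 hgA).trans ?_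
    calc volume A ^ (p.toReal - q) * extEnergy Q q g
        ≤ volume A ^ (p.toReal - q) * (K * volume A) := by gcongr; exact hK A hA hAu g hgm hg1 hgA
      _ = K * (volume A ^ (1 : ℝ) * volume A ^ (p.toReal - q)) := by rw [ENNReal.rpow_one]; ring
      _ = _ := by rw [ENNReal.rpow_add_of_nonneg _ _ zero_le_one (by linarith)]
  refine (ENNReal.rpow_le_rpow h1 (by positivity)).trans_eq ?_
  rw [ENNReal.mul_rpow_of_nonneg _ _ (by positivity), ← ENNReal.rpow_mul, mul_one_div]

/-! ### Dyadic decomposition and summation -/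

/-- The truncation of `g` at height `2 ^ m`. -/
noncomputable def dyadicTrunc (g : (Fin n → ℝ) → ℂ) (m : ℕ) : (Fin n → ℝ) → ℂ :=
  {ξ | ‖g ξ‖ ≤ 2 ^ m}.indicator g

lemma measurable_dyadicTrunc {g : (Fin n → ℝ) → ℂ} (hg : Measurable g) (m : ℕ) :
    Measurable (dyadicTrunc g m) :=
  hg.indicator (measurableSet_le hg.norm measurable_const)

lemma norm_dyadicTrunc_le (g : (Fin n → ℝ) → ℂ) (m : ℕ) (ξ : Fin n → ℝ) :
    ‖dyadicTrunc g m ξ‖ ≤ 2 ^ m := by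
  by_cases h : ξ ∈ {ξ | ‖g ξ‖ ≤ 2 ^ m}
  · rw [dyadicTrunc, Set.indicator_of_mem h]; exact h
  · rw [dyadicTrunc, Set.indicator_of_notMem h, norm_zero]; positivity

lemma dyadicTrunc_eq_zero {g : (Fin n → ℝ) → ℂ} (hg0 : ∀ ξ ∉ unitCube n, g ξ = 0) (m : ℕ) :
    ∀ ξ ∉ unitCube n, dyadicTrunc g m ξ = 0 := fun ξ hξ => by
  simp [dyadicTrunc, hg0 ξ hξ]

lemma integrable_dyadicTrunc {g : (Fin n → ℝ) → ℂ} (hg : Measurable g)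
    (hg0 : ∀ ξ ∉ unitCube n, g ξ = 0) (m : ℕ) : Integrable (dyadicTrunc g m) :=
  integrable_of_bounded_of_support (measurable_dyadicTrunc hg m) (norm_dyadicTrunc_le g m)
    (volume_Icc_ne_top 0 1) (dyadicTrunc_eq_zero hg0 m)

lemma volume_lt_norm_le {g : (Fin n → ℝ) → ℂ} (hg : Measurable g) {p : ℝ≥0∞} (hp0 : p ≠ 0)
    (hp : p ≠ ∞) (hgp : eLpNorm g p volume ≤ 1) (m : ℕ) :
    volume {ξ | 2 ^ m < ‖g ξ‖} ≤ ((2 : ℝ≥0∞) ^ m) ^ (-p.toReal) := by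
  have h := mul_meas_ge_le_pow_eLpNorm' volume hp0 hp hg.aestronglyMeasurable ((2 : ℝ≥0∞) ^ m)
  have h1 : ((2 : ℝ≥0∞) ^ m) ^ p.toReal * volume {ξ | 2 ^ m < ‖g ξ‖} ≤ 1 := by
    refine (le_trans ?_ h).trans (ENNReal.rpow_le_one hgp ENNReal.toReal_nonneg)
    gcongr
    intro hξ
    rw [← ofReal_norm]
    refine le_trans ?_ (ENNReal.ofReal_le_ofReal hξ.le)
    rw [ENNReal.ofReal_pow zero_le_two, ENNReal.ofReal_ofNat]
  have hb : ((2 : ℝ≥0∞) ^ m) ≠ ∞ := by simp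
  have hb0 : ((2 : ℝ≥0∞) ^ m) ≠ 0 := by simp
  rw [ENNReal.rpow_neg, ← one_div, ENNReal.le_div_iff_mul_le
    (Or.inl (ENNReal.rpow_pos hb0.bot_lt hb).ne')
    (Or.inl (ENNReal.rpow_ne_top_of_nonneg ENNReal.toReal_nonneg hb)), mul_comm]
  exact h1

/-- The layer has height at most `2^(m+1)` and, by Chebyshev, support of measure at most `2^(-mp)`.
The restricted bound turns this into `2^(m+1) * 2^(-m(1+p-q))`, up to `K^(1/p)`. -/
lemma RestrictedBound.eLpNorm_layer_le {Q : QuadraticForm ℝ (Fin n → ℝ)} {q : ℝ} {K : ℝ≥0∞}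
    (hK : RestrictedBound Q q K) (hq : 0 < q) {p : ℝ≥0∞} (hp : p ≠ ∞) (hqp : q < p.toReal)
    {g : (Fin n → ℝ) → ℂ} (hg : Measurable g) (hg0 : ∀ ξ ∉ unitCube n, g ξ = 0)
    (hgp : eLpNorm g p volume ≤ 1) (m : ℕ) :
    eLpNorm (fullExt Q (dyadicTrunc g (m + 1) - dyadicTrunc g m)) p volume ≤
      2 * K ^ (1 / p.toReal) * ((2 : ℝ≥0∞) ^ (-(p.toReal - q))) ^ m := by
  have hp0 : p ≠ 0 := by rintro rfl; simp at hqp; linarith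
  have hpr : 0 < p.toReal := hq.trans hqp
  have hS : MeasurableSet {ξ | 2 ^ m < ‖g ξ‖} := measurableSet_lt measurable_const hg.norm
  have hsub : {ξ | 2 ^ m < ‖g ξ‖} ⊆ unitCube n := fun ξ hξ => by
    by_contra h
    rw [Set.mem_ofPred_eq, hg0 ξ h, norm_zero] at hξ
    exact absurd hξ (not_lt.2 (by positivity))
  have hmono : (2 : ℝ) ^ m ≤ 2 ^ (m + 1) := pow_le_pow_right₀ one_le_two m.le_succ
  have hzero : ∀ ξ ∉ {ξ | 2 ^ m < ‖g ξ‖}, (dyadicTrunc g (m + 1) - dyadicTrunc g m) ξ = 0 :=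
    fun ξ hξ => by
      have h1 : ‖g ξ‖ ≤ 2 ^ m := not_lt.1 hξ
      simp [dyadicTrunc, h1, h1.trans hmono]
  have hbd : ∀ ξ, ‖(dyadicTrunc g (m + 1) - dyadicTrunc g m) ξ‖ ≤ 2 ^ (m + 1) := fun ξ => by
    by_cases hξ : 2 ^ m < ‖g ξ‖
    · have h1 : dyadicTrunc g m ξ = 0 := by simp [dyadicTrunc, hξ]
      rw [Pi.sub_apply, h1, sub_zero]
      exact norm_dyadicTrunc_le g _ ξ
    · rw [hzero ξ hξ, norm_zero]; positivity
  refine (hK.eLpNorm_le hq hp hqp hS hsub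
    ((measurable_dyadicTrunc hg _).sub (measurable_dyadicTrunc hg _)) (by positivity)
    hbd hzero).trans ?_
  have hb : ((2 : ℝ≥0∞) ^ m) ≠ ∞ := by simp
  have hb0 : ((2 : ℝ≥0∞) ^ m) ≠ 0 := by simp
  have hvol : volume {ξ | 2 ^ m < ‖g ξ‖} ^ ((1 + (p.toReal - q)) / p.toReal) ≤
      ((2 : ℝ≥0∞) ^ m) ^ (-(1 + (p.toReal - q))) := by
    refine (ENNReal.rpow_le_rpow (volume_lt_norm_le hg hp0 hp hgp m)
      (div_nonneg (by linarith) hpr.le)).trans_eq ?_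
    rw [← ENNReal.rpow_mul]
    congr 1
    field_simp
  calc ENNReal.ofReal (2 ^ (m + 1)) *
      (K ^ (1 / p.toReal) * volume {ξ | 2 ^ m < ‖g ξ‖} ^ ((1 + (p.toReal - q)) / p.toReal))
      ≤ (2 ^ (m + 1)) * (K ^ (1 / p.toReal) * ((2 : ℝ≥0∞) ^ m) ^ (-(1 + (p.toReal - q)))) := by
        rw [ENNReal.ofReal_pow zero_le_two, ENNReal.ofReal_ofNat]
        gcongr
    _ = 2 * K ^ (1 / p.toReal) *
        (((2 : ℝ≥0∞) ^ m) ^ (1 : ℝ) * ((2 : ℝ≥0∞) ^ m) ^ (-(1 + (p.toReal - q)))) := by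
        rw [ENNReal.rpow_one, pow_succ]; ring
    _ = _ := by
        rw [← ENNReal.rpow_add _ _ hb0 hb, ← ENNReal.rpow_natCast, ← ENNReal.rpow_natCast,
          ← ENNReal.rpow_mul, ← ENNReal.rpow_mul]
        congr 2
        ring

lemma tendsto_fullExt_dyadicTrunc (Q : QuadraticForm ℝ (Fin n → ℝ)) {g : (Fin n → ℝ) → ℂ}
    (hg : Measurable g) (hgi : Integrable g) (z : (Fin n → ℝ) × ℝ) :
    Filter.Tendsto (fun m => fullExt Q (dyadicTrunc g m) z) Filter.atTop
      (nhds (fullExt Q g z)) := by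
  refine tendsto_integral_of_dominated_convergence (fun ξ => ‖g ξ‖) (fun m => ?_) hgi.norm
    (fun m => ae_of_all _ fun ξ => ?_) (ae_of_all _ fun ξ => ?_)
  · exact ((measurable_dyadicTrunc hg m).mul
      (continuous_osc_right Q z).measurable).aestronglyMeasurable
  · rw [norm_mul, norm_osc, mul_one]
    exact norm_indicator_le_norm_self _ _
  · refine tendsto_const_nhds.congr' ?_
    obtain ⟨m₀, hm₀⟩ := pow_unbounded_of_one_lt ‖g ξ‖ one_lt_two
    filter_upwards [Filter.eventually_ge_atTop m₀] with m hm
    have h : ξ ∈ {ξ | ‖g ξ‖ ≤ 2 ^ m} := hm₀.le.trans (pow_le_pow_right₀ one_le_two hm)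
    rw [dyadicTrunc, Set.indicator_of_mem h]

/-- The truncation at height one costs `K^(1/p)`, the layers a geometric series of ratio `2^(-(p-q))
< 1`. Fatou passes the uniform bound from the truncations to `g`. -/
lemma RestrictedBound.exists_eLpNorm_le {Q : QuadraticForm ℝ (Fin n → ℝ)} {q : ℝ} {K : ℝ≥0∞}
    (hK : RestrictedBound Q q K) (hK' : K ≠ ∞) (hq : 1 ≤ q) {p : ℝ≥0∞} (hp : p ≠ ∞)
    (hqp : q < p.toReal) :
    ∃ C : ℝ≥0∞, C ≠ ∞ ∧ ∀ g : (Fin n → ℝ) → ℂ, Measurable g → Integrable g →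
      (∀ ξ ∉ unitCube n, g ξ = 0) → eLpNorm g p volume ≤ 1 →
        eLpNorm (fullExt Q g) p volume ≤ C := by
  have hq0 : 0 < q := by linarith
  have hp1 : 1 ≤ p := by
    rw [← ENNReal.ofReal_toReal hp, ENNReal.one_le_ofReal]
    linarith
  have hKp : K ^ (1 / p.toReal) ≠ ∞ := ENNReal.rpow_ne_top_of_nonneg (by positivity) hK'
  set r : ℝ≥0∞ := 2 ^ (-(p.toReal - q)) with hr
  have hr1 : r < 1 := by
    rw [hr, ENNReal.rpow_neg]
    exact ENNReal.inv_lt_one.2 (ENNReal.one_lt_rpow (by norm_num) (by linarith))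
  refine ⟨K ^ (1 / p.toReal) + 2 * K ^ (1 / p.toReal) * (1 - r)⁻¹, ?_, fun g hg hgi hg0 hgp => ?_⟩
  · refine ENNReal.add_ne_top.2 ⟨hKp, ENNReal.mul_ne_top (ENNReal.mul_ne_top (by simp) hKp) ?_⟩
    exact ENNReal.inv_ne_top.2 (tsub_pos_of_lt hr1).ne'
  have hmeas : ∀ m, AEStronglyMeasurable (fullExt Q (dyadicTrunc g m)) volume := fun m =>
    (stronglyMeasurable_fullExt Q (measurable_dyadicTrunc hg m)).aestronglyMeasurable
  have hsum : ∀ m, eLpNorm (fullExt Q (dyadicTrunc g m)) p volume ≤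
      K ^ (1 / p.toReal) + 2 * K ^ (1 / p.toReal) * ∑ k ∈ Finset.range m, r ^ k := by
    intro m
    induction m with
    | zero =>
      have h := hK.eLpNorm_le hq0 hp hqp measurableSet_unitCube subset_rfl
        (measurable_dyadicTrunc hg 0) one_pos (fun ξ => by simpa using norm_dyadicTrunc_le g 0 ξ)
        (dyadicTrunc_eq_zero hg0 0)
      simpa [volume_unitCube] using h
    | succ m ih =>
      have hi := integrable_dyadicTrunc hg hg0
      have hsplit : dyadicTrunc g (m + 1) =
          dyadicTrunc g m + (dyadicTrunc g (m + 1) - dyadicTrunc g m) := by abel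
      rw [hsplit, fullExt_add Q (hi m) ((hi (m + 1)).sub (hi m))]
      refine (eLpNorm_add_le (hmeas m) (stronglyMeasurable_fullExt Q
        ((measurable_dyadicTrunc hg _).sub
          (measurable_dyadicTrunc hg _))).aestronglyMeasurable hp1).trans ?_
      rw [Finset.sum_range_succ, mul_add, ← add_assoc]
      exact add_le_add ih (hK.eLpNorm_layer_le hq0 hp hqp hg hg0 hgp m)
  refine (Lp.eLpNorm_lim_le_liminf_eLpNorm hmeas _
    (ae_of_all _ (tendsto_fullExt_dyadicTrunc Q hg hgi))).trans ?_
  refine Filter.liminf_le_of_frequently_le' (Filter.Frequently.of_forall fun m => ?_)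
  refine (hsum m).trans ?_
  gcongr
  rw [← ENNReal.tsum_geometric]
  exact ENNReal.sum_le_tsum _

/-! ### Assembly for general `L^p` functions -/

lemma exists_restrictedBound (Q : QuadraticForm ℝ (Fin n → ℝ)) {p₀ : ℝ≥0∞} (hp : 2 ≤ p₀)
    (hp' : p₀ ≠ ∞) (hrestr : ∃ C : ℝ≥0, ∀ g ∈ signedCharFun n,
      eLpNorm (extensionOp Q g) p₀ volume ≤ C * eLpNorm g ∞ (quadricMeasure n)) :
    ∃ K : ℝ≥0∞, K ≠ ∞ ∧ RestrictedBound Q p₀.toReal K := by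
  obtain ⟨C, hC⟩ := hrestr
  have hq : 2 ≤ p₀.toReal := by
    have := ENNReal.toReal_mono hp' hp
    simpa using this
  have hq0 : 0 < p₀.toReal := by linarith
  have hp0 : p₀ ≠ 0 := by rintro rfl; simp at hp
  have hD : ∀ g ∈ signedCharFun n, extEnergy Q p₀.toReal g ≤ (C : ℝ≥0∞) ^ p₀.toReal := by
    intro g hg
    have h1 : eLpNorm g ∞ (quadricMeasure n) ≤ 1 := by
      rw [eLpNorm_exponent_top]
      refine eLpNormEssSup_le_of_ae_enorm_bound (ae_of_all _ fun ξ => ?_)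
      rw [← ofReal_norm]
      refine ENNReal.ofReal_le_one.2 ?_
      by_cases hξ : ξ ∈ unitCube n
      · rcases hg.2.1 ξ hξ with h | h
        · simp [h]
        · exact h.le
      · simp [hg.2.2 ξ hξ]
    have h2 : extEnergy Q p₀.toReal g ^ (1 / p₀.toReal) ≤ C := by
      rw [← eLpNorm_fullExt_eq Q hp0 hp', ← extensionOp_eq_fullExt Q g hg.2.2]
      exact (hC g hg).trans (mul_le_of_le_one_right' h1)
    rwa [one_div, ENNReal.rpow_inv_le_iff hq0] at h2
  obtain ⟨M, hM, h⟩ := exists_extEnergy_le_of_signedCharFun Q (by linarith)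
    (ENNReal.rpow_ne_top_of_nonneg hq0.le ENNReal.coe_ne_top) hD
  obtain ⟨M', hM', h'⟩ := exists_extEnergy_le_of_support_double Q hq0.le hM h
  refine ⟨2 * (2 ^ p₀.toReal * M'), ENNReal.mul_ne_top (by simp) (ENNReal.mul_ne_top
    (ENNReal.rpow_ne_top_of_nonneg hq0.le (by simp)) hM'), fun A hA hAu f hf hf1 hfA => ?_⟩
  exact extEnergy_le_volume Q hq hM' h' hA hAu hf hf1 hfA

/-- Allows work with genuinely measurable functions vanishing off the cube. Norms must agree for all
exponents, since both `p` and `1` are used. -/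
lemma exists_measurable_representative (Q : QuadraticForm ℝ (Fin n → ℝ)) {p : ℝ≥0∞}
    {g : (Fin n → ℝ) → ℂ} (hg : MemLp g p (quadricMeasure n)) (hp : 1 ≤ p) :
    ∃ f : (Fin n → ℝ) → ℂ, Measurable f ∧ Integrable f ∧ (∀ ξ ∉ unitCube n, f ξ = 0) ∧
      (∀ r, eLpNorm f r volume = eLpNorm g r (quadricMeasure n)) ∧
      extensionOp Q g = fullExt Q f := by
  have hae := hg.1.ae_eq_mk
  have hfm : Measurable ((unitCube n).indicator (hg.1.mk g)) :=
    hg.1.stronglyMeasurable_mk.measurable.indicator measurableSet_unitCube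
  have hnorm : ∀ r, eLpNorm ((unitCube n).indicator (hg.1.mk g)) r volume =
      eLpNorm g r (quadricMeasure n) := fun r => by
    rw [eLpNorm_indicator_eq_eLpNorm_restrict measurableSet_unitCube]
    exact eLpNorm_congr_ae hae.symm
  have h0 : ∀ ξ ∉ unitCube n, (unitCube n).indicator (hg.1.mk g) ξ = 0 :=
    fun ξ hξ => Set.indicator_of_notMem hξ _
  refine ⟨_, hfm, ?_, h0, hnorm, ?_⟩
  · rw [← memLp_one_iff_integrable]
    refine ⟨hfm.aestronglyMeasurable, ?_⟩
    rw [hnorm]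
    exact (hg.mono_exponent hp).2
  · rw [← extensionOp_eq_fullExt Q _ h0]
    ext z
    refine integral_congr_ae ?_
    filter_upwards [hae, ae_restrict_mem measurableSet_unitCube] with ξ h1 h2
    rw [Set.indicator_of_mem h2, ← h1]

lemma eLpNorm_fullExt_le_of_unit_ball (Q : QuadraticForm ℝ (Fin n → ℝ)) {p C : ℝ≥0∞}
    (hp : p ≠ 0)
    (h : ∀ g : (Fin n → ℝ) → ℂ, Measurable g → Integrable g → (∀ ξ ∉ unitCube n, g ξ = 0) →
      eLpNorm g p volume ≤ 1 → eLpNorm (fullExt Q g) p volume ≤ C)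
    {f : (Fin n → ℝ) → ℂ} (hf : Measurable f) (hfi : Integrable f)
    (hf0 : ∀ ξ ∉ unitCube n, f ξ = 0) (hfp : eLpNorm f p volume ≠ ∞) :
    eLpNorm (fullExt Q f) p volume ≤ C * eLpNorm f p volume := by
  rcases eq_or_ne (eLpNorm f p volume) 0 with h0 | h0
  · rw [fullExt_eq_zero_of_ae Q ((eLpNorm_eq_zero_iff hf.aestronglyMeasurable hp).1 h0)]
    simp
  set t := (eLpNorm f p volume).toReal with ht
  have ht0 : 0 < t := ENNReal.toReal_pos h0 hfp
  have hnorm : ∀ s : ℝ, 0 ≤ s → ‖(s : ℂ)‖ₑ = ENNReal.ofReal s := fun s hs => by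
    rw [← ofReal_norm, Complex.norm_real, Real.norm_of_nonneg hs]
  have hft : ENNReal.ofReal t = eLpNorm f p volume := ENNReal.ofReal_toReal hfp
  have hfg : f = (t : ℂ) • (((t⁻¹ : ℝ) : ℂ) • f) := by
    rw [smul_smul, ← Complex.ofReal_mul, mul_inv_cancel₀ ht0.ne', Complex.ofReal_one, one_smul]
  have h1 : eLpNorm (((t⁻¹ : ℝ) : ℂ) • f) p volume ≤ 1 := by
    rw [eLpNorm_const_smul, hnorm _ (by positivity), ← hft, ← ENNReal.ofReal_mul (by positivity),
      inv_mul_cancel₀ ht0.ne', ENNReal.ofReal_one]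
  have h2 := h _ (hf.const_smul _) (hfi.smul _) (fun ξ hξ => by simp [hf0 ξ hξ]) h1
  rw [hfg, fullExt_smul, eLpNorm_const_smul, hnorm t ht0.le, hft, mul_comm, ← hfg]
  gcongr

lemma eLpNorm_top_fullExt_le (Q : QuadraticForm ℝ (Fin n → ℝ)) (f : (Fin n → ℝ) → ℂ) :
    eLpNorm (fullExt Q f) ∞ volume ≤ eLpNorm f 1 volume := by
  rw [eLpNorm_exponent_top, eLpNorm_one_eq_lintegral_enorm]
  exact eLpNormEssSup_le_of_ae_enorm_bound (ae_of_all _ fun z => enorm_fullExt_le Q f z)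

end QuadricExtension

open QuadricExtension in
theorem mainTheorem2 (n : ℕ) (hn : 1 ≤ n) (Q : QuadraticForm ℝ (Fin n → ℝ))
    (p₀ : ℝ≥0∞) (hp₀ : ((2 * n + 2 : ℕ) : ℝ≥0∞) / (n : ℝ≥0∞) < p₀)
    (hrestr : ∃ C : ℝ≥0, ∀ g ∈ QuadricExtension.signedCharFun n,
      eLpNorm (QuadricExtension.extensionOp Q g) p₀ volume ≤
        C * eLpNorm g ∞ (QuadricExtension.quadricMeasure n))
    (p : ℝ≥0∞) (hp : p₀ < p) :
    ∃ C' : ℝ≥0, ∀ g : (Fin n → ℝ) → ℂ, MemLp g p (QuadricExtension.quadricMeasure n) →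
      MemLp (QuadricExtension.extensionOp Q g) p volume ∧
        eLpNorm (QuadricExtension.extensionOp Q g) p volume ≤
          C' * eLpNorm g p (QuadricExtension.quadricMeasure n) := by
  -- The lower bound on `p₀` enters through `(2n+2)/n ≥ 2`, as required by Clarkson's inequality.
  have hp2 : 2 ≤ p₀ := by
    refine le_trans ?_ hp₀.le
    rw [ENNReal.le_div_iff_mul_le (Or.inl (by simp; omega)) (Or.inl (by simp))]
    exact_mod_cast Nat.le_add_right (2 * n) 2
  have hp1 : 1 ≤ p := (one_le_two.trans hp2).trans hp.le
  -- The comparison of the `L^1` and `L^p` norms, valid as the cube has measure one, serves the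
  -- endpoint `p = ∞`.
  suffices h : ∃ C' : ℝ≥0∞, C' ≠ ∞ ∧ ∀ f : (Fin n → ℝ) → ℂ, Measurable f → Integrable f →
      (∀ ξ ∉ unitCube n, f ξ = 0) → eLpNorm f p volume ≠ ∞ →
      eLpNorm f 1 volume ≤ eLpNorm f p volume →
      eLpNorm (fullExt Q f) p volume ≤ C' * eLpNorm f p volume by
    obtain ⟨C', hC', h⟩ := h
    refine ⟨C'.toNNReal, fun g hg => ?_⟩
    obtain ⟨f, hf, hfi, hf0, hfn, hfE⟩ := exists_measurable_representative Q hg hp1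
    have hfp : eLpNorm f p volume ≠ ∞ := by rw [hfn]; exact hg.2.ne
    have h1 : eLpNorm f 1 volume ≤ eLpNorm f p volume := by
      rw [hfn, hfn]
      exact eLpNorm_le_eLpNorm_of_exponent_le hp1 hg.1
    have hb := h f hf hfi hf0 hfp h1
    rw [hfE, ENNReal.coe_toNNReal hC', ← hfn]
    exact ⟨⟨(stronglyMeasurable_fullExt Q hf).aestronglyMeasurable,
      hb.trans_lt (ENNReal.mul_lt_top hC'.lt_top hfp.lt_top)⟩, hb⟩
  rcases eq_or_ne p ∞ with rfl | hpt
  · refine ⟨1, ENNReal.one_ne_top, fun f _ _ _ _ h1 => ?_⟩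
    rw [one_mul]
    exact (eLpNorm_top_fullExt_le Q f).trans h1
  · obtain ⟨K, hK, hKb⟩ := exists_restrictedBound Q hp2 hp.ne_top hrestr
    have hq : 1 ≤ p₀.toReal := by
      have := ENNReal.toReal_mono hp.ne_top (one_le_two.trans hp2)
      simpa using this
    obtain ⟨C, hC, h⟩ := hKb.exists_eLpNorm_le hK hq hpt
      ((ENNReal.toReal_lt_toReal hp.ne_top hpt).2 hp)
    exact ⟨C, hC, fun f hf hfi hf0 hfp _ =>
      eLpNorm_fullExt_le_of_unit_ball Q (one_pos.trans_le hp1).ne' h hf hfi hf0 hfp⟩
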